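/- Let $\mathbb F_q$ be a finite field with $q$ elements, and let $\mathbb F_q((T^{-1}))$ be the field of Laurent series in $T^{-1}$ over $\mathbb F_q$, with the absolute value $|0|=0$ and $|\xi|=q^{-N}$ for $\xi=\sum_{k\ge N}a_kT^{-k}$, $a_N\ne 0$. Let $C_\infty$ be the completion of an algebraic closure of $\mathbb F_q((T^{-1}))$ with respect to the unique extension of $|\cdot|$. An element $\alpha$ of $C_\infty$ is called algebraic if it is a root of a nonzero polynomial with coefficients in $\mathbb F_q[T]$; it is then a root of a polynomial $P_\alpha(X)$ irreducible in $\mathbb F_q[T][X]$, unique up to a factor in $\mathbb F_q^\times$ (its minimal defining polynomial over $\mathbb F_q[T]$). The degree of $\alpha$ is the degree of $P_\alpha$ in $X$, and the height $H(\alpha)$ is the maximum of the absolute values of the coefficients of $P_\alpha$. For $\xi\in\mathbb F_q((T^{-1}))$ and an integer $n\ge 1$, let $w_n^*(\xi)$ (respectively $w_n^@(\xi)$) be the supremum, in $[-\infty,+\infty]$, of the real numbers $w$ for which $$0<|\xi-\alpha|<H(\alpha)^{-w-1}$$ has infinitely many solutions in algebraic elements $\alpha$ of $\mathbb F_q((T^{-1}))$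 (respectively of $C_\infty$) of degree at most $n$. Then, for every $\xi\in\mathbb F_q((T^{-1}))$ and every integer $n\ge 1$, $$w_n^*(\xi)=w_n^@(\xi).$$ -/

import Mathlib

open scoped LaurentSeries Polynomial NNReal WithZero

noncomputable section

namespace KoksmaExponents

variable (F : Type*) [Field F]

/-! ### The field `F((T⁻¹))` with its absolute value

For a finite field `F` with `q` elements, the field `F((T⁻¹))` is the field `F⸨X⸩` of Laurent series
in the variable `X = T⁻¹`. Its absolute value is `|ξ| = q ^ (-N)`, where `N` is the least exponent of
`T⁻¹` occurring in `ξ` (see `norm_eq` below). -/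

/-- The embedding of the polynomial ring `F[T]` in `F((T⁻¹))`; it is the identity on `F` and maps
`T` to `(T⁻¹)⁻¹`. -/
def polyEmb : F[X] →+* F⸨X⸩ :=
  Polynomial.eval₂RingHom HahnSeries.C (HahnSeries.single (-1) 1)

theorem coeff_polyEmb (R : F[X]) (n : ℕ) : (polyEmb F R).coeff (-n) = R.coeff n := by
  induction R using Polynomial.induction_on' with
  | add p q hp hq => simp [map_add, hp, hq]
  | monomial k a =>
    have h : polyEmb F (Polynomial.monomial k a) = HahnSeries.single (-(k : ℤ)) a := by
      simp [polyEmb, HahnSeries.single_pow, HahnSeries.C_apply, HahnSeries.single_mul_single]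
    rw [h, Polynomial.coeff_monomial, HahnSeries.coeff_single]
    simp [eq_comm]

theorem polyEmb_injective : Function.Injective (polyEmb F) := fun P Q h =>
  Polynomial.ext fun n => by rw [← coeff_polyEmb, h, coeff_polyEmb]

variable [Finite F]

lemma one_lt_card : (1 : ℝ≥0) < (Nat.card F : ℝ≥0) := by
  exact_mod_cast Finite.one_lt_card (α := F)

lemma card_ne_zero : (Nat.card F : ℝ≥0) ≠ 0 := (zero_lt_one.trans (one_lt_card F)).ne'

open MonoidWithZeroHom.ValueGroup₀ in
/-- The `T⁻¹`-adic valuation has rank one, through `exp (-N) ↦ q ^ (-N)`. -/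
instance rankOne : (Valued.v : Valuation F⸨X⸩ ℤᵐ⁰).RankOne where
  hom' := (WithZeroMulInt.toNNReal (card_ne_zero F)).comp embedding
  strictMono' := (WithZeroMulInt.toNNReal_strictMono (one_lt_card F)).comp embedding_strictMono
  exists_val_nontrivial := by
    refine ⟨HahnSeries.single 1 (1 : F), ?_⟩
    rw [LaurentSeries.valuation_single_zpow]
    exact ⟨WithZero.exp_ne_zero, by
      rw [← WithZero.exp_zero, Ne, WithZero.exp_inj]; norm_num⟩

instance nontriviallyNormedField : NontriviallyNormedField F⸨X⸩ :=
  Valued.toNontriviallyNormedField F⸨X⸩ ℤᵐ⁰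

instance isUltrametricDist : IsUltrametricDist F⸨X⸩ :=
  IsUltrametricDist.isUltrametricDist_of_forall_norm_add_le_max_norm
    (Valued.isNonarchimedean_norm F⸨X⸩ ℤᵐ⁰)

theorem norm_eq {ξ : F⸨X⸩} (hξ : ξ ≠ 0) : ‖ξ‖ = (Nat.card F : ℝ) ^ (-ξ.order) := by
  have hv : Valued.v ξ = WithZero.exp (-ξ.order) := by
    apply le_antisymm
    · rw [LaurentSeries.valuation_le_iff_coeff_lt_eq_zero]
      exact fun n hn => HahnSeries.coeff_eq_zero_of_lt_order hn
    · by_contra! h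
      have h' : Valued.v ξ ≤ WithZero.exp (-(ξ.order + 1)) := by
        rw [← WithZero.log_lt_iff_lt_exp (by simpa using hξ)] at h
        rw [← WithZero.log_le_iff_le_exp (by simpa using hξ)]
        omega
      rw [LaurentSeries.valuation_le_iff_coeff_lt_eq_zero] at h'
      exact HahnSeries.coeff_order_eq_zero.not.mpr hξ (h' _ (by omega))
  change ((WithZeroMulInt.toNNReal (card_ne_zero F)
    (MonoidWithZeroHom.ValueGroup₀.embedding (Valued.v.restrict ξ)) : ℝ≥0) : ℝ) = _
  rw [Valuation.embedding_restrict, hv, WithZeroMulInt.toNNReal_neg_apply _ WithZero.exp_ne_zero,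
    NNReal.coe_zpow]
  rfl

/-! ### The field `C_∞` -/

/-- An algebraic closure of `F((T⁻¹))`, with the unique extension of the absolute value. -/
abbrev AlgCl := AlgebraicClosure F⸨X⸩

instance algClNormedField : NormedField (AlgCl F) := spectralNorm.normedField F⸨X⸩ (AlgCl F)

/-- The completion `C_∞` of the algebraic closure of `F((T⁻¹))`. -/
abbrev CInfty := UniformSpace.Completion (AlgCl F)

/-- The embedding of `F((T⁻¹))` in `C_∞`. -/
def toCInfty : F⸨X⸩ →+* CInfty F :=
  UniformSpace.Completion.coeRingHom.comp (algebraMap F⸨X⸩ (AlgCl F))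

theorem norm_toCInfty (ξ : F⸨X⸩) : ‖toCInfty F ξ‖ = ‖ξ‖ :=
  (UniformSpace.Completion.norm_coe _).trans (spectralNorm_extends ξ)

variable {F}

/-! ### Heights and exponents of approximation -/

/-- The height of a polynomial `P(X)` over `F[T]`: the maximum of the absolute values of its
coefficients. -/
def height (P : F[X][X]) : ℝ≥0 := P.support.sup fun i => ‖polyEmb F (P.coeff i)‖₊

/-- `P` is a minimal defining polynomial over `F[T]` of the element `α` of a field `E` in which
`F[T]` is embedded by `φ`: it is irreducible in `F[T][X]` and vanishes at `α`. Such a `P` exists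
exactly if `α` is algebraic; it is then unique up to a factor in `Fˣ`, its degree is the degree of
`α`, and its height is the height of `α`. -/
def IsMinDefPoly {E : Type*} [Field E] (φ : F[X] →+* E) (α : E) (P : F[X][X]) : Prop :=
  Irreducible P ∧ P.eval₂ φ α = 0

theorem IsMinDefPoly.associated {E : Type*} [Field E] {φ : F[X] →+* E}
    (hφ : Function.Injective φ) {α : E} {P Q : F[X][X]} (hP : IsMinDefPoly φ α P)
    (hQ : IsMinDefPoly φ α Q) : Associated P Q := by
  have key : ∀ {R : F[X][X]}, IsMinDefPoly φ α R → R.IsPrimitive := by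
    rintro R ⟨h1, h2⟩
    refine h1.isPrimitive fun h0 => ?_
    rw [Polynomial.eq_C_of_natDegree_eq_zero h0, Polynomial.eval₂_C] at h2
    have h3 := hφ (h2.trans (map_zero φ).symm)
    apply h1.ne_zero
    rw [Polynomial.eq_C_of_natDegree_eq_zero h0, h3, map_zero]
  have ev : ∀ {R : F[X][X]}, IsMinDefPoly φ α R →
      (R.map (algebraMap F[X] (FractionRing F[X]))).eval₂ (IsFractionRing.lift hφ) α = 0 := by
    rintro R ⟨_, h2⟩
    rw [Polynomial.eval₂_map, ← h2]
    congr 1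
    exact RingHom.ext fun x => by simp
  have irr := ((key hP).irreducible_iff_irreducible_map_fraction_map
    (K := FractionRing F[X])).mp hP.1
  apply hP.1.associated_of_dvd hQ.1
  apply (key hP).dvd_of_fraction_map_dvd_fraction_map (K := FractionRing F[X])
  by_contra hnd
  obtain ⟨a, b, hab⟩ := irr.coprime_iff_not_dvd.mpr hnd
  have := congrArg (Polynomial.eval₂ (IsFractionRing.lift hφ) α) hab
  simp [Polynomial.eval₂_add, Polynomial.eval₂_mul, ev hP, ev hQ] at this

theorem height_eq_of_associated {P Q : F[X][X]} (h : Associated P Q) : height P = height Q := by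
  obtain ⟨u, rfl⟩ := h
  obtain ⟨v, hv, hu⟩ := Polynomial.isUnit_iff.mp u.isUnit
  obtain ⟨c, hc, rfl⟩ := Polynomial.isUnit_iff.mp hv
  have hc0 : c ≠ 0 := hc.ne_zero
  have hn : ‖polyEmb F (Polynomial.C c)‖₊ = 1 := by
    have h0 : polyEmb F (Polynomial.C c) = HahnSeries.C c := by simp [polyEmb]
    have h1 : (HahnSeries.C c : F⸨X⸩) ≠ 0 := by simpa using hc0
    ext
    rw [coe_nnnorm, h0, norm_eq F h1]
    rw [HahnSeries.order_C, neg_zero, zpow_zero, NNReal.coe_one]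
  have hs : (P * (u : F[X][X])).support = P.support := by
    ext i
    simp [← hu, Polynomial.coeff_mul_C, hc0]
  unfold height
  rw [hs]
  refine Finset.sup_congr rfl fun i _ => ?_
  rw [← hu, Polynomial.coeff_mul_C, map_mul, nnnorm_mul, hn, mul_one]

theorem exists_isMinDefPoly {E : Type*} [Field E] {φ : F[X] →+* E} {α : E} {Q : F[X][X]}
    (hQ : Q ≠ 0) (h : Q.eval₂ φ α = 0) : ∃ P, IsMinDefPoly φ α P := by
  induction Q using UniqueFactorizationMonoid.induction_on_prime with
  | h₁ => exact absurd rfl hQ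
  | h₂ x hx =>
    have := hx.map (Polynomial.eval₂RingHom φ α)
    simp [h] at this
  | h₃ a p ha hp ih =>
    rw [Polynomial.eval₂_mul, mul_eq_zero] at h
    exact h.elim (fun h => ⟨p, hp.irreducible, h⟩) (ih ha)

/-- The algebraic elements `α` of `E`, of degree at most `n`, such that
`0 < |ξ - α| < H(α) ^ (-w - 1)`. -/
def approximants {E : Type*} [NormedField E] (φ : F[X] →+* E) (n : ℕ) (ξ : E) (w : ℝ) : Set E :=
  {α | ∃ P : F[X][X], IsMinDefPoly φ α P ∧ P.natDegree ≤ n ∧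
    0 < ‖ξ - α‖ ∧ ‖ξ - α‖ < (height P : ℝ) ^ (-w - 1)}

/-- The supremum, in `[-∞, +∞]`, of the real numbers `w` for which
`0 < |ξ - α| < H(α) ^ (-w - 1)` has infinitely many solutions in algebraic elements `α` of `E` of
degree at most `n`. -/
def exponent {E : Type*} [NormedField E] (φ : F[X] →+* E) (n : ℕ) (ξ : E) : EReal :=
  sSup ((fun w : ℝ => (w : EReal)) '' {w : ℝ | (approximants φ n ξ w).Infinite})

/-- The exponent `w_n^*(ξ)`: the approximants are taken in `F((T⁻¹))`. -/
def wStar (n : ℕ) (ξ : F⸨X⸩) : EReal := exponent (polyEmb F) n ξ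

/-- The exponent `w_n^@(ξ)`: the approximants are taken in `C_∞`. -/
def wAt (n : ℕ) (ξ : F⸨X⸩) : EReal :=
  exponent ((toCInfty F).comp (polyEmb F)) n (toCInfty F ξ)

end KoksmaExponents

end

noncomputable section

namespace KoksmaExponents

/-! ### Polynomials over an ultrametric field -/

section Ultrametric

open Polynomial

variable {E : Type*} [NormedField E]

/-! Algebraic elements of `C_∞` already lie in the algebraic closure of `F((T⁻¹))`, so the point is
to replace an approximant `α` there by one in `F((T⁻¹))`. Among the algebraic numbers of degree at
most `n` and height at most `H(α)`, other than `ξ`, take one closest to `ξ`. It lies in `F((T⁻¹))`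
once `α` is close enough to `ξ` (`exists_approximant_mem`), because an element outside `F((T⁻¹))` of
large height `H` is never closest (`exists_closer`).

The reason is that such an element `α` has a second conjugate, counted with multiplicity, at the
same distance from `ξ`, so a resultant with its minimal polynomial `P` contains two small factors,
yet it is a nonzero element of `F[T]` and has absolute value at least 1 (`one_le_mul_height_pow`).

If `ξ` is not algebraic of degree at most `n`, a Dirichlet argument gives `Q` of height less than
`H` with `|Q(ξ)| ≪ H ^ (-n)`. Were no root of `Q` closer to `ξ` than `α`, both conjugates would
satisfy `|Q| ≤ |Q(ξ)|`, and the resultant of `P` and `Q` would be `≪ H ^ (-2)`.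

If `ξ` has degree `d ≤ n` and minimal polynomial `P₀`, the resultant of `P` and `P₀` gives `|ξ - α|
≫ H ^ (-d / 2)`, whereas a perturbation of a multiple of `P₀` has a root at distance `≪ H ^ (-d)`
from `ξ`. This needs `P₀'(ξ) ≠ 0`, that is, the separability of `ξ` over `F(T)`
(`IsMinDefPoly.eval₂_derivative_ne_zero`). -/

theorem supNorm_le {p : E[X]} {B : ℝ} (h : ∀ i, ‖p.coeff i‖ ≤ B) : p.supNorm ≤ B := by
  obtain ⟨i, hi⟩ := p.exists_eq_supNorm
  exact hi ▸ h i

theorem norm_multiset_prod_eq (s : Multiset E) : ‖s.prod‖ = (s.map norm).prod := by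
  induction s using Multiset.induction_on with
  | empty => simp
  | cons a s ih => simp [ih]

theorem norm_eval_eq_of_splits {p : E[X]} (hp : p.Splits) (x : E) :
    ‖p.eval x‖ = ‖p.leadingCoeff‖ * (p.roots.map fun a => ‖x - a‖).prod := by
  conv_lhs => rw [hp.eq_prod_roots, eval_mul, eval_C, norm_mul, eval_multiset_prod,
    norm_multiset_prod_eq, Multiset.map_map, Multiset.map_map]
  simp

variable [IsUltrametricDist E]

theorem supNorm_mul (p q : E[X]) : (p * q).supNorm = p.supNorm * q.supNorm :=
  gaussNorm_mul (v := NormedField.toAbsoluteValue E) IsUltrametricDist.isNonarchimedean_norm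
    one_pos p q

theorem supNorm_add_le (p q : E[X]) : (p + q).supNorm ≤ max p.supNorm q.supNorm :=
  supNorm_le fun i => by
    rw [coeff_add]
    exact (IsUltrametricDist.norm_add_le_max _ _).trans
      (max_le_max (p.le_supNorm i) (q.le_supNorm i))

theorem supNorm_X_sub_C (a : E) : (X - C a).supNorm = max 1 ‖a‖ := by
  apply le_antisymm
  · rw [sub_eq_add_neg, ← C_neg]
    refine (supNorm_add_le _ _).trans ?_
    rw [supNorm_X, supNorm_C, norm_neg]
  · refine max_le ?_ ?_
    · have h := (X - C a).le_supNorm 1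
      rwa [coeff_sub, coeff_X_one, coeff_C_succ, sub_zero, norm_one] at h
    · have h := (X - C a).le_supNorm 0
      rwa [coeff_sub, coeff_X_zero, coeff_C_zero, zero_sub, norm_neg] at h

theorem supNorm_multiset_prod_X_sub_C (s : Multiset E) :
    (s.map fun a => X - C a).prod.supNorm = (s.map fun a => max 1 ‖a‖).prod := by
  induction s using Multiset.induction_on with
  | empty => simpa using supNorm_C (A := E) (a := 1)
  | cons a s ih => simp [supNorm_mul, supNorm_X_sub_C, ih]

/-- By Gauss's lemma the sup norm is multiplicative, which makes it the ultrametric Mahler measure.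
-/
theorem supNorm_eq_of_splits {p : E[X]} (hp : p.Splits) :
    p.supNorm = ‖p.leadingCoeff‖ * (p.roots.map fun a => max 1 ‖a‖).prod := by
  conv_lhs => rw [hp.eq_prod_roots, supNorm_mul, supNorm_C, supNorm_multiset_prod_X_sub_C]

theorem norm_eval_le {p : E[X]} {n : ℕ} (hn : p.natDegree ≤ n) (x : E) :
    ‖p.eval x‖ ≤ p.supNorm * max 1 ‖x‖ ^ n := by
  rw [eval_eq_sum_range]
  refine IsUltrametricDist.norm_sum_le_of_forall_le_of_nonneg
    (mul_nonneg p.supNorm_nonneg (by positivity)) fun i hi => ?_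
  rw [norm_mul, norm_pow]
  gcongr
  · exact p.supNorm_nonneg
  · exact p.le_supNorm i
  · calc ‖x‖ ^ i ≤ max 1 ‖x‖ ^ i := by gcongr; exact le_max_right _ _
      _ ≤ max 1 ‖x‖ ^ n := by
        gcongr
        · exact le_max_left _ _
        · have := Finset.mem_range.mp hi; omega

theorem supNorm_derivative_le (p : E[X]) : p.derivative.supNorm ≤ p.supNorm :=
  supNorm_le fun i => by
    rw [coeff_derivative, norm_mul]
    have h : ‖((i : E) + 1)‖ ≤ 1 := by
      exact_mod_cast IsUltrametricDist.norm_natCast_le_one E (i + 1)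
    calc _ ≤ p.supNorm * 1 := by
          gcongr
          · exact p.supNorm_nonneg
          · exact p.le_supNorm _
      _ = _ := mul_one _

/-- If no root of `p` is closer to `x` than `y`, then `|p(y)| ≤ |p(x)|`. -/
theorem norm_eval_le_norm_eval {p : E[X]} (hp : p.Splits) {x y : E}
    (h : ∀ a ∈ p.roots, ‖x - y‖ ≤ ‖x - a‖) : ‖p.eval y‖ ≤ ‖p.eval x‖ := by
  rw [norm_eval_eq_of_splits hp, norm_eval_eq_of_splits hp]
  gcongr
  refine Multiset.prod_map_le_prod_map₀ _ _ (fun _ _ => norm_nonneg _) fun a ha => ?_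
  have : y - a = -(x - y) + (x - a) := by ring
  rw [this]
  refine (IsUltrametricDist.norm_add_le_max _ _).trans (max_le ?_ le_rfl)
  rw [norm_neg]
  exact h a ha

/-- Divide by `X - C x`: its sup norm is at least 1, so the cofactor has sup norm at most that of
`p`. -/
theorem norm_eval_le_of_eval_eq_zero {p : E[X]} {n : ℕ} (hn : p.natDegree ≤ n) {x : E}
    (hx : p.eval x = 0) (y : E) :
    ‖p.eval y‖ ≤ ‖x - y‖ * p.supNorm * max 1 ‖y‖ ^ n := by
  rcases eq_or_ne p 0 with rfl | hp0
  · simp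
  obtain ⟨g, rfl⟩ := dvd_iff_isRoot.mpr hx
  have hg : g.natDegree ≤ n := le_trans (natDegree_le_of_dvd (dvd_mul_left _ _) hp0) hn
  rw [eval_mul, supNorm_mul, supNorm_X_sub_C, norm_mul, mul_assoc]
  have h1 : ‖eval y (X - C x)‖ = ‖x - y‖ := by simp [norm_sub_rev]
  rw [h1]
  gcongr
  refine (norm_eval_le hg y).trans ?_
  gcongr
  exact le_mul_of_one_le_left g.supNorm_nonneg (le_max_left _ _)

/-- A polynomial has a root at distance at most `|p(x) / p'(x)|` from `x`. -/
theorem exists_root_norm_sub_mul_le {p : E[X]} (hp : p.Splits) {x : E}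
    (hd : p.derivative.eval x ≠ 0) :
    ∃ a ∈ p.roots, ‖x - a‖ * ‖p.derivative.eval x‖ ≤ ‖p.eval x‖ := by
  have hp0 : p ≠ 0 := by rintro rfl; simp at hd
  rcases eq_or_ne (p.eval x) 0 with hx | hx
  · exact ⟨x, by simp [hp0, hx], by simp⟩
  -- The logarithmic derivative `p'/p` is the sum of the `1 / (x - a)`; by the ultrametric
  -- inequality some term is at least as large as the sum.
  have key := hp.eval_derivative_div_eval_of_ne_zero hx
  have hne : p.roots ≠ 0 := by
    intro h
    rw [h] at key
    simp [hd, hx] at key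
  obtain ⟨a, ha, hle⟩ := IsUltrametricDist.exists_norm_multiset_sum_le p.roots
    (f := fun z => 1 / (x - z))
  have ha := ha hne
  refine ⟨a, ha, ?_⟩
  rw [← key, norm_div] at hle
  have hxa : x - a ≠ 0 := by
    intro h
    rw [sub_eq_zero] at h
    subst h
    exact hx (isRoot_of_mem_roots ha)
  rw [norm_div, norm_one, div_le_div_iff₀ (norm_pos_iff.mpr hx) (norm_pos_iff.mpr hxa)] at hle
  linarith

/-- In the product of the `q(z)` over the roots `z` of `p`, two factors are small and the others are
bounded trivially; the factors `max 1 ‖z‖` and the leading coefficient recombine to `p.supNorm ^ m`.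
Since `a` and `b` are entries of a multiset, a double root is allowed. -/
theorem norm_resultant_le {p q : E[X]} (hp : p.Splits) {m : ℕ} (hm : q.natDegree ≤ m)
    {a b : E} {s : Multiset E} (hs : p.roots = a ::ₘ b ::ₘ s) {δ : ℝ} (hδ : 0 ≤ δ)
    (ha : ‖q.eval a‖ ≤ δ * max 1 ‖a‖ ^ m) (hb : ‖q.eval b‖ ≤ δ * max 1 ‖b‖ ^ m) :
    ‖resultant p q p.natDegree m‖ ≤
      δ ^ 2 * p.supNorm ^ m * q.supNorm ^ (p.natDegree - 2) := by
  have hcard : p.natDegree - 2 = s.card := by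
    rw [hp.natDegree_eq_card_roots, hs]; simp
  have hrest : (s.map fun z => ‖q.eval z‖).prod ≤
      q.supNorm ^ s.card * ((s.map fun z => max 1 ‖z‖).prod) ^ m := by
    calc _ ≤ (s.map fun z => q.supNorm * max 1 ‖z‖ ^ m).prod :=
          Multiset.prod_map_le_prod_map₀ _ _ (fun _ _ => norm_nonneg _)
            fun z _ => norm_eval_le hm z
      _ = _ := by
          rw [Multiset.prod_map_mul, Multiset.map_const', Multiset.prod_replicate,
            Multiset.prod_map_pow]
  have hnn : 0 ≤ (s.map fun z => ‖q.eval z‖).prod := Multiset.prod_nonneg fun x h => by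
    obtain ⟨z, -, rfl⟩ := Multiset.mem_map.mp h
    exact norm_nonneg _
  rw [resultant_eq_prod_eval _ _ _ hm hp, norm_mul, norm_multiset_prod_eq, Multiset.map_map,
    supNorm_eq_of_splits hp, hs, hcard, norm_pow]
  simp only [Multiset.map_cons, Multiset.prod_cons, Function.comp_apply]
  calc _ ≤ ‖p.leadingCoeff‖ ^ m * ((δ * max 1 ‖a‖ ^ m) * ((δ * max 1 ‖b‖ ^ m) *
        (q.supNorm ^ s.card * ((s.map fun z => max 1 ‖z‖).prod) ^ m))) := by
        gcongr
    _ = _ := by ring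

end Ultrametric

/-! ### Minimal defining polynomials -/

section MinDefPoly

variable {F : Type*} [Field F]

/-- The divisibility is what passes bounds on degree and height from `Q` to the minimal defining
polynomial. -/
theorem exists_isMinDefPoly_dvd {E : Type*} [Field E] {φ : F[X] →+* E} {α : E} {Q : F[X][X]}
    (hQ : Q ≠ 0) (h : Q.eval₂ φ α = 0) : ∃ P, P ∣ Q ∧ IsMinDefPoly φ α P := by
  induction Q using UniqueFactorizationMonoid.induction_on_prime with
  | h₁ => exact absurd rfl hQ
  | h₂ x hx =>
    have := hx.map (Polynomial.eval₂RingHom φ α)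
    simp [h] at this
  | h₃ a p ha hp ih =>
    rw [Polynomial.eval₂_mul, mul_eq_zero] at h
    rcases h with h | h
    · exact ⟨p, dvd_mul_right _ _, hp.irreducible, h⟩
    · obtain ⟨P, hP, hP'⟩ := ih ha h
      exact ⟨P, hP.mul_left _, hP'⟩

theorem isMinDefPoly_comp_iff {E E' : Type*} [Field E] [Field E'] (φ : F[X] →+* E) (ψ : E →+* E')
    (α : E) (P : F[X][X]) : IsMinDefPoly (ψ.comp φ) (ψ α) P ↔ IsMinDefPoly φ α P := by
  unfold IsMinDefPoly
  rw [← Polynomial.hom_eval₂, map_eq_zero]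

theorem IsMinDefPoly.natDegree_ne_zero {E : Type*} [Field E] {φ : F[X] →+* E}
    (hφ : Function.Injective φ) {α : E} {P : F[X][X]} (hP : IsMinDefPoly φ α P) :
    P.natDegree ≠ 0 := fun h0 => by
  have h2 := hP.2
  rw [Polynomial.eq_C_of_natDegree_eq_zero h0, Polynomial.eval₂_C] at h2
  apply hP.1.ne_zero
  rw [Polynomial.eq_C_of_natDegree_eq_zero h0, hφ (h2.trans (map_zero φ).symm), map_zero]

variable [Finite F]

theorem IsMinDefPoly.dvd {E : Type*} [Field E] {φ : F[X] →+* E}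
    (hφ : Function.Injective φ) {α : E} {P Q : F[X][X]} (hP : IsMinDefPoly φ α P)
    (h : Q.eval₂ φ α = 0) : P ∣ Q := by
  rcases eq_or_ne Q 0 with rfl | hQ
  · exact dvd_zero P
  obtain ⟨P', hd, hP'⟩ := exists_isMinDefPoly_dvd hQ h
  exact (hP.associated hφ hP').dvd.trans hd

end MinDefPoly

/-! ### The absolute value and the height -/

section Height

variable {F : Type*} [Field F] [Finite F]

theorem one_lt_natCard_real : (1 : ℝ) < Nat.card F := by
  exact_mod_cast Finite.one_lt_card (α := F)

theorem norm_polyEmb {R : F[X]} (hR : R ≠ 0) :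
    ‖polyEmb F R‖ = (Nat.card F : ℝ) ^ R.natDegree := by
  have h0 : polyEmb F R ≠ 0 := (map_ne_zero_iff _ (polyEmb_injective F)).mpr hR
  have hle : (polyEmb F R).order ≤ -(R.natDegree : ℤ) :=
    HahnSeries.order_le_of_coeff_ne_zero (by
      rw [coeff_polyEmb, Polynomial.coeff_natDegree]
      exact Polynomial.leadingCoeff_ne_zero.mpr hR)
  obtain ⟨k, hk⟩ : ∃ k : ℕ, (polyEmb F R).order = -(k : ℤ) :=
    ⟨(polyEmb F R).order.natAbs, by omega⟩
  have hc := HahnSeries.coeff_order_eq_zero.not.mpr h0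
  rw [hk, coeff_polyEmb] at hc
  have hk' := Polynomial.le_natDegree_of_ne_zero hc
  have : k = R.natDegree := by omega
  rw [norm_eq F h0, hk, this, neg_neg, zpow_natCast]

theorem one_le_norm_polyEmb {R : F[X]} (hR : R ≠ 0) : 1 ≤ ‖polyEmb F R‖ := by
  rw [norm_polyEmb hR]
  exact one_le_pow₀ one_lt_natCard_real.le

theorem norm_polyEmb_le_iff {R : F[X]} {N : ℕ} :
    ‖polyEmb F R‖ ≤ (Nat.card F : ℝ) ^ N ↔ R.natDegree ≤ N := by
  rcases eq_or_ne R 0 with rfl | hR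
  · simp
  · rw [norm_polyEmb hR]
    exact pow_le_pow_iff_right₀ one_lt_natCard_real

theorem height_le_iff {P : F[X][X]} {B : ℝ} (hB : 0 ≤ B) :
    (height P : ℝ) ≤ B ↔ ∀ i, ‖polyEmb F (P.coeff i)‖ ≤ B := by
  lift B to ℝ≥0 using hB
  rw [NNReal.coe_le_coe, height, Finset.sup_le_iff]
  refine ⟨fun h i => ?_, fun h i _ => ?_⟩
  · by_cases hi : i ∈ P.support
    · exact_mod_cast h i hi
    · rw [Polynomial.notMem_support_iff.mp hi]
      simp
  · exact_mod_cast h i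

theorem norm_coeff_le_height (P : F[X][X]) (i : ℕ) : ‖polyEmb F (P.coeff i)‖ ≤ height P :=
  (height_le_iff (height P).2).mp le_rfl i

theorem height_le_pow_iff {P : F[X][X]} {N : ℕ} :
    (height P : ℝ) ≤ (Nat.card F : ℝ) ^ N ↔ ∀ i, (P.coeff i).natDegree ≤ N := by
  rw [height_le_iff (by positivity)]
  exact forall_congr' fun i => norm_polyEmb_le_iff

theorem exists_height_eq {P : F[X][X]} (hP : P ≠ 0) :
    ∃ N : ℕ, (height P : ℝ) = (Nat.card F : ℝ) ^ N := by
  obtain ⟨i, hi, h⟩ := P.support.exists_mem_eq_sup (Polynomial.support_nonempty.mpr hP)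
    (fun i => ‖polyEmb F (P.coeff i)‖₊)
  refine ⟨(P.coeff i).natDegree, ?_⟩
  rw [height, h, coe_nnnorm, norm_polyEmb (Polynomial.mem_support_iff.mp hi)]

theorem one_le_height {P : F[X][X]} (hP : P ≠ 0) : (1 : ℝ) ≤ height P := by
  obtain ⟨N, hN⟩ := exists_height_eq hP
  rw [hN]
  exact one_le_pow₀ one_lt_natCard_real.le

theorem supNorm_map_eq_height {E : Type*} [NormedField E] {φ : F[X] →+* E}
    (hφ : ∀ R, ‖φ R‖ = ‖polyEmb F R‖) (P : F[X][X]) : (P.map φ).supNorm = height P := by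
  apply le_antisymm
  · exact supNorm_le fun i => by
      rw [Polynomial.coeff_map, hφ]
      exact norm_coeff_le_height P i
  · rw [height_le_iff (Polynomial.supNorm_nonneg _)]
    intro i
    rw [← hφ, ← Polynomial.coeff_map]
    exact Polynomial.le_supNorm _ i

theorem height_mul (P Q : F[X][X]) : (height (P * Q) : ℝ) = height P * height Q := by
  simp only [← supNorm_map_eq_height (φ := polyEmb F) (fun _ => rfl), Polynomial.map_mul,
    supNorm_mul]

/-- Height is multiplicative by Gauss's lemma, and a nonzero cofactor has height at least 1. -/
theorem height_le_of_dvd {P Q : F[X][X]} (h : P ∣ Q) (hQ : Q ≠ 0) :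
    (height P : ℝ) ≤ height Q := by
  obtain ⟨R, rfl⟩ := h
  rw [height_mul]
  exact le_mul_of_one_le_right (height P).2 (one_le_height (right_ne_zero_of_mul hQ))

theorem finite_setOf_height_le (n : ℕ) (B : ℝ) :
    {P : F[X][X] | P.natDegree ≤ n ∧ (height P : ℝ) ≤ B}.Finite := by
  obtain ⟨N, hN⟩ := pow_unbounded_of_one_lt B (one_lt_natCard_real (F := F))
  have hfin : Finite (Polynomial.degreeLT F (N + 1)) :=
    Finite.of_equiv _ (Polynomial.degreeLTEquiv F (N + 1)).toEquiv.symm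
  let f : (Fin (n + 1) → Polynomial.degreeLT F (N + 1)) → F[X][X] := fun c =>
    ∑ i : Fin (n + 1), Polynomial.monomial (i : ℕ) (c i : F[X])
  refine (Set.finite_range f).subset ?_
  rintro P ⟨hd, hh⟩
  have hc := height_le_pow_iff.mp (hh.trans hN.le)
  refine ⟨fun i => ⟨P.coeff i, Polynomial.mem_degreeLT.mpr
    ((Polynomial.degree_lt_iff_coeff_zero _ _).mpr fun m hm =>
      Polynomial.coeff_eq_zero_of_natDegree_lt (by have := hc i; omega))⟩, ?_⟩
  simp only [f]
  rw [Fin.sum_univ_eq_sum_range (fun i => Polynomial.monomial i (P.coeff i))]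
  exact (P.as_sum_range' (n + 1) (by omega)).symm

/-- There are finitely many algebraic elements of bounded degree and height. -/
theorem finite_setOf_isMinDefPoly_height_le {E : Type*} [Field E] {φ : F[X] →+* E}
    (hφ : Function.Injective φ) (n : ℕ) (B : ℝ) :
    {α : E | ∃ P, IsMinDefPoly φ α P ∧ P.natDegree ≤ n ∧ (height P : ℝ) ≤ B}.Finite := by
  refine ((finite_setOf_height_le (F := F) n B).biUnion
    (t := fun P => {α | α ∈ (P.map φ).roots}) fun P _ => ?_).subset ?_
  · classical
    exact (P.map φ).roots.toFinset.finite_toSet.subset fun α hα => by simpa using hα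
  · rintro α ⟨P, hP, hd, hh⟩
    refine Set.mem_biUnion (x := P) ⟨hd, hh⟩ ?_
    have h0 := (Polynomial.map_ne_zero_iff hφ).mpr hP.1.ne_zero
    simpa [h0, Polynomial.eval_map] using hP.2

end Height

section AlgebraicClosure

variable {F : Type*} [Field F]

/-! ### The algebraic closure of `F((T⁻¹))` -/

variable (F) in
/-- The embedding of `F[T]` in the algebraic closure of `F((T⁻¹))`. -/
def polyEmbCl : F[X] →+* AlgCl F := (algebraMap F⸨X⸩ (AlgCl F)).comp (polyEmb F)

theorem polyEmbCl_injective : Function.Injective (polyEmbCl F) :=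
  (algebraMap F⸨X⸩ (AlgCl F)).injective.comp (polyEmb_injective F)

theorem eval_map_polyEmbCl_algebraMap (P : F[X][X]) (ξ : F⸨X⸩) :
    (P.map (polyEmbCl F)).eval (algebraMap F⸨X⸩ (AlgCl F) ξ) =
      algebraMap F⸨X⸩ (AlgCl F) (P.eval₂ (polyEmb F) ξ) := by
  rw [Polynomial.eval_map, polyEmbCl, Polynomial.hom_eval₂]

variable [Finite F]

theorem norm_algebraMap_algCl (x : F⸨X⸩) : ‖algebraMap F⸨X⸩ (AlgCl F) x‖ = ‖x‖ :=
  spectralNorm_extends x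

instance algClIsUltrametricDist : IsUltrametricDist (AlgCl F) :=
  IsUltrametricDist.isUltrametricDist_of_forall_norm_add_le_max_norm
    (isNonarchimedean_spectralNorm (K := F⸨X⸩) (L := AlgCl F))

theorem norm_polyEmbCl (R : F[X]) : ‖polyEmbCl F R‖ = ‖polyEmb F R‖ :=
  norm_algebraMap_algCl _

theorem supNorm_map_polyEmbCl (P : F[X][X]) : (P.map (polyEmbCl F)).supNorm = height P :=
  supNorm_map_eq_height norm_polyEmbCl P

/-- The spectral norm depends only on the minimal polynomial, and translation by `ξ` acts on minimal
polynomials. -/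
theorem norm_sub_eq_of_minpoly_eq {a b : AlgCl F} (h : minpoly F⸨X⸩ a = minpoly F⸨X⸩ b)
    (ξ : F⸨X⸩) :
    ‖algebraMap F⸨X⸩ (AlgCl F) ξ - a‖ = ‖algebraMap F⸨X⸩ (AlgCl F) ξ - b‖ := by
  rw [norm_sub_rev, norm_sub_rev _ b]
  change spectralValue (minpoly F⸨X⸩ _) = spectralValue (minpoly F⸨X⸩ _)
  rw [minpoly.sub_algebraMap, minpoly.sub_algebraMap, h]

/-- If a root `α` of `P` does not lie in `F((T⁻¹))`, then `P` has a further root at the same distance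
from `ξ`. -/
theorem exists_roots_eq_cons_cons {P : F[X][X]} (hP : P ≠ 0) {α : AlgCl F}
    (hα : α ∉ Set.range (algebraMap F⸨X⸩ (AlgCl F))) (h : P.eval₂ (polyEmbCl F) α = 0)
    (ξ : F⸨X⸩) :
    ∃ (b : AlgCl F) (s : Multiset (AlgCl F)), (P.map (polyEmbCl F)).roots = α ::ₘ b ::ₘ s ∧
      ‖algebraMap F⸨X⸩ (AlgCl F) ξ - b‖ = ‖algebraMap F⸨X⸩ (AlgCl F) ξ - α‖ := by
  have hint : IsIntegral F⸨X⸩ α := Algebra.IsIntegral.isIntegral α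
  have hmap : P.map (polyEmbCl F) =
      (P.map (polyEmb F)).map (algebraMap F⸨X⸩ (AlgCl F)) := by
    rw [Polynomial.map_map]; rfl
  have hP0 : P.map (polyEmbCl F) ≠ 0 :=
    (Polynomial.map_ne_zero_iff polyEmbCl_injective).mpr hP
  set m := (minpoly F⸨X⸩ α).map (algebraMap F⸨X⸩ (AlgCl F)) with hm
  have hm0 : m ≠ 0 := Polynomial.map_ne_zero (minpoly.ne_zero hint)
  have hdvd : m ∣ P.map (polyEmbCl F) := by
    rw [hmap]
    refine Polynomial.map_dvd _ (minpoly.dvd _ _ ?_)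
    rw [Polynomial.aeval_def, Polynomial.eval₂_map]
    exact h
  -- Roots are counted with multiplicity, so `b = α` may occur when `α` is inseparable.
  have hcard : 2 ≤ m.roots.card := by
    rw [← (IsAlgClosed.splits m).natDegree_eq_card_roots, Polynomial.natDegree_map]
    exact (minpoly.two_le_natDegree_iff hint).mpr hα
  have hαm : α ∈ m.roots := by
    rw [Polynomial.mem_roots hm0, Polynomial.IsRoot, Polynomial.eval_map_algebraMap,
      minpoly.aeval]
  obtain ⟨t, ht⟩ := Multiset.exists_cons_of_mem hαm
  have ht0 : 0 < t.card := by rw [ht, Multiset.card_cons] at hcard; omega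
  obtain ⟨b, hb⟩ := Multiset.card_pos_iff_exists_mem.mp ht0
  obtain ⟨u, rfl⟩ := Multiset.exists_cons_of_mem hb
  obtain ⟨v, hv⟩ := Multiset.le_iff_exists_add.mp (Polynomial.roots.le_of_dvd hP0 hdvd)
  refine ⟨b, u + v, by rw [hv, ht]; simp, norm_sub_eq_of_minpoly_eq ?_ ξ⟩
  have hbm : b ∈ m.roots := by rw [ht]; simp
  rw [Polynomial.mem_roots hm0, Polynomial.IsRoot, Polynomial.eval_map_algebraMap] at hbm
  exact (minpoly.eq_of_irreducible_of_monic (minpoly.irreducible hint) hbm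
    (minpoly.monic hint)).symm

/-- The resultant of `P` and `Q` is a nonzero element of `F[T]` unless `P` divides `Q`. -/
theorem one_le_norm_resultant {P Q : F[X][X]} (hP : Irreducible P) (hPQ : ¬ P ∣ Q) {m : ℕ}
    (hm : Q.natDegree ≤ m) :
    1 ≤ ‖Polynomial.resultant (P.map (polyEmbCl F)) (Q.map (polyEmbCl F))
      (P.map (polyEmbCl F)).natDegree m‖ := by
  have hP0 : P.map (polyEmbCl F) ≠ 0 :=
    (Polynomial.map_ne_zero_iff polyEmbCl_injective).mpr hP.ne_zero
  have hne : Polynomial.resultant (P.map (polyEmbCl F)) (Q.map (polyEmbCl F))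
      (P.map (polyEmbCl F)).natDegree m ≠ 0 := by
    rw [Polynomial.resultant_eq_prod_eval _ _ _
      (Polynomial.natDegree_map_le.trans hm) (IsAlgClosed.splits _)]
    refine mul_ne_zero (pow_ne_zero _ (Polynomial.leadingCoeff_ne_zero.mpr hP0)) ?_
    rw [Ne, Multiset.prod_eq_zero_iff, Multiset.mem_map]
    rintro ⟨a, ha, h⟩
    rw [Polynomial.mem_roots hP0, Polynomial.IsRoot, Polynomial.eval_map] at ha
    rw [Polynomial.eval_map] at h
    exact hPQ (IsMinDefPoly.dvd polyEmbCl_injective ⟨hP, ha⟩ h)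
  -- The resultant commutes with the embedding, hence is the image of an element of `F[T]`.
  rw [Polynomial.resultant_map_map] at hne ⊢
  rw [norm_polyEmbCl]
  exact one_le_norm_polyEmb fun h => hne (by rw [h, map_zero])

end AlgebraicClosure

section Dirichlet

variable {F : Type*} [Field F]

/-! ### Polynomials with small values -/

theorem finrank_degreeLT (m : ℕ) : Module.finrank F (Polynomial.degreeLT F m) = m := by
  rw [(Polynomial.degreeLTEquiv F m).finrank_eq, Module.finrank_fin_fun]

variable (F) in
/-- The polynomial with coefficients `c 0, …, c n`, as a linear function of `c`. -/
def ofCoeffs (n m : ℕ) : (Fin (n + 1) → Polynomial.degreeLT F m) →ₗ[F] F[X][X] :=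
  ∑ i : Fin (n + 1), ((Polynomial.monomial (R := F[X]) (i : ℕ)).restrictScalars F) ∘ₗ
    (Polynomial.degreeLT F m).subtype ∘ₗ LinearMap.proj i

theorem ofCoeffs_apply (n m : ℕ) (c : Fin (n + 1) → Polynomial.degreeLT F m) :
    ofCoeffs F n m c = ∑ i : Fin (n + 1), Polynomial.monomial (i : ℕ) (c i : F[X]) := by
  simp [ofCoeffs]

theorem coeff_ofCoeffs (n m : ℕ) (c : Fin (n + 1) → Polynomial.degreeLT F m) (k : ℕ) :
    (ofCoeffs F n m c).coeff k = if h : k < n + 1 then (c ⟨k, h⟩ : F[X]) else 0 := by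
  rw [ofCoeffs_apply, Polynomial.finsetSum_coeff]
  simp only [Polynomial.coeff_monomial]
  split_ifs with h
  · rw [Finset.sum_eq_single ⟨k, h⟩]
    · simp
    · intro b _ hb
      rw [if_neg fun h' => hb (Fin.ext h')]
    · simp
  · refine Finset.sum_eq_zero fun i _ => if_neg fun h' => h (by omega)

variable (F) in
/-- The values at `ξ` of polynomials over `F[T]`, as an `F`-linear map. -/
def evalLinear (ξ : F⸨X⸩) : F[X][X] →ₗ[F] F⸨X⸩ where
  toFun Q := Q.eval₂ (polyEmb F) ξ
  map_add' P Q := Polynomial.eval₂_add _ _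
  map_smul' a Q := by
    have : a • Q = Polynomial.C (Polynomial.C a) * Q := by
      ext i j; simp
    rw [this, Polynomial.eval₂_mul, Polynomial.eval₂_C]
    simp [polyEmb]

variable [Finite F]

theorem norm_eval₂_le {Q : F[X][X]} {n : ℕ} (hn : Q.natDegree ≤ n) (ξ : F⸨X⸩) :
    ‖Q.eval₂ (polyEmb F) ξ‖ ≤ height Q * max 1 ‖ξ‖ ^ n := by
  rw [← Polynomial.eval_map, ← supNorm_map_eq_height (φ := polyEmb F) (fun _ => rfl)]
  exact norm_eval_le (Polynomial.natDegree_map_le.trans hn) ξ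

/-- There are nonzero polynomials of degree at most `n` and height at most `q ^ N` whose value at
`ξ` is `O(q ^ (-n (N + 1)))`. -/
theorem exists_height_le_norm_eval_le (ξ : F⸨X⸩) (n : ℕ) :
    ∃ C : ℝ, 0 < C ∧ ∀ N : ℕ, ∃ Q : F[X][X], Q ≠ 0 ∧ Q.natDegree ≤ n ∧
      (height Q : ℝ) ≤ (Nat.card F : ℝ) ^ N ∧
      ‖Q.eval₂ (polyEmb F) ξ‖ * (Nat.card F : ℝ) ^ ((N + 1) * n) ≤ C := by
  have hq := one_lt_natCard_real (F := F)
  have hq0 : (0 : ℝ) < Nat.card F := by linarith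
  obtain ⟨k, hk⟩ := pow_unbounded_of_one_lt (max 1 ‖ξ‖ ^ n) hq
  refine ⟨(Nat.card F : ℝ) ^ k, by positivity, fun N => ?_⟩
  -- One linear condition fewer than there are free coefficients in `F`.
  let r := (n + 1) * (N + 1) - 1
  have hr : r + 1 = (n + 1) * (N + 1) := Nat.sub_add_cancel (Nat.mul_pos n.succ_pos N.succ_pos)
  -- The conditions kill the coefficients of `Q(ξ)` from index `-(N + k)` on; the earlier ones
  -- vanish because `|Q(ξ)| ≤ q ^ (N + k)`.
  let f : (Fin (n + 1) → Polynomial.degreeLT F (N + 1)) →ₗ[F] (Fin r → F) :=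
    LinearMap.pi fun j : Fin r =>
      { toFun := fun c => (evalLinear F ξ (ofCoeffs F n (N + 1) c)).coeff (j - (N + k : ℤ))
        map_add' := fun c d => by simp
        map_smul' := fun a c => by simp }
  have hker : LinearMap.ker f ≠ ⊥ := LinearMap.ker_ne_bot_of_finrank_lt (by
    rw [Module.finrank_fin_fun, Module.finrank_pi_fintype]
    simp only [finrank_degreeLT, Finset.sum_const, Finset.card_univ, Fintype.card_fin, smul_eq_mul]
    omega)
  obtain ⟨c, hc, hc0⟩ := Submodule.exists_mem_ne_zero_of_ne_bot hker
  set Q := ofCoeffs F n (N + 1) c with hQ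
  have hdeg : Q.natDegree ≤ n := Polynomial.natDegree_le_iff_coeff_eq_zero.mpr fun i hi => by
    rw [hQ, coeff_ofCoeffs, dif_neg (by omega)]
  have hh : (height Q : ℝ) ≤ (Nat.card F : ℝ) ^ N := height_le_pow_iff.mpr fun i => by
    rw [hQ, coeff_ofCoeffs]
    split_ifs with h
    · exact Polynomial.natDegree_le_iff_coeff_eq_zero.mpr fun j hj =>
        (Polynomial.degree_lt_iff_coeff_zero _ _).mp (Polynomial.mem_degreeLT.mp (c ⟨i, h⟩).2) j hj
    · simp
  refine ⟨Q, fun h0 => hc0 ?_, hdeg, hh, ?_⟩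
  · funext i
    have := coeff_ofCoeffs n (N + 1) c i
    rw [← hQ, h0, dif_pos i.2] at this
    exact Subtype.ext (by simpa using this.symm)
  · set y := Q.eval₂ (polyEmb F) ξ with hy
    rcases eq_or_ne y 0 with h0 | h0
    · rw [h0, norm_zero, zero_mul]; positivity
    have h1 : ‖y‖ ≤ (Nat.card F : ℝ) ^ ((N + k : ℕ) : ℤ) := by
      rw [zpow_natCast, pow_add]
      exact (norm_eval₂_le hdeg ξ).trans (by gcongr)
    rw [norm_eq F h0] at h1 ⊢
    have h2 := (zpow_le_zpow_iff_right₀ hq).mp h1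
    have h3 : (r : ℤ) - (N + k) ≤ y.order := by
      by_contra! hlt
      obtain ⟨j, hj⟩ := Int.eq_ofNat_of_zero_le (a := y.order + (N + k)) (by push_cast at h2; omega)
      have hjr : j < r := by omega
      have := congrFun (LinearMap.mem_ker.mp hc) ⟨j, hjr⟩
      have hyo : y.coeff ((j : ℤ) - (N + k)) = 0 := this
      rw [← hj, add_sub_cancel_right] at hyo
      exact HahnSeries.coeff_order_eq_zero.not.mpr h0 hyo
    rw [← zpow_natCast, ← zpow_add₀ hq0.ne', ← zpow_natCast]
    refine zpow_le_zpow_right₀ hq.le ?_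
    have hr' : (r : ℤ) + 1 = (n + 1) * (N + 1) := by exact_mod_cast hr
    push_cast
    linarith

end Dirichlet

section Separable

variable {F : Type*} [Field F] [Finite F]

/-! ### Algebraic elements of `F((T⁻¹))` are separable over `F(T)` -/

/-- As `F` is perfect, `1, T, …, T ^ (p - 1)` span `F[T]` over its `p`-th powers. -/
theorem exists_eq_sum_X_pow_mul_pow (p : ℕ) [hp : Fact p.Prime] [CharP F p] (S : F[X]) :
    ∃ c : ℕ → F[X], S = ∑ j ∈ Finset.range p, Polynomial.X ^ j * c j ^ p := by
  induction S using Polynomial.induction_on' with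
  | add P Q hP hQ =>
    obtain ⟨c, hc⟩ := hP
    obtain ⟨d, hd⟩ := hQ
    refine ⟨fun j => c j + d j, ?_⟩
    simp only [add_pow_char, mul_add, Finset.sum_add_distrib]
    rw [← hc, ← hd]
  | monomial k a =>
    obtain ⟨b, hb⟩ : ∃ b : F, b ^ p = a := surjective_frobenius F p a
    refine ⟨fun j => if j = k % p then Polynomial.monomial (k / p) b else 0, ?_⟩
    rw [Finset.sum_eq_single (k % p)]
    · beta_reduce
      rw [if_pos rfl, Polynomial.monomial_pow, hb, Polynomial.X_pow_mul_monomial,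
        mul_comm (k / p), Nat.div_add_mod]
    · intro j _ hj
      beta_reduce
      rw [if_neg hj, zero_pow hp.out.ne_zero, mul_zero]
    · intro h
      exact absurd (Finset.mem_range.mpr (Nat.mod_lt _ hp.out.pos)) h

theorem exists_expand_eq_sum (p : ℕ) [hp : Fact p.Prime] [CharP F p] (S : F[X][X]) :
    ∃ g : ℕ → F[X][X], (∀ j, (g j).natDegree ≤ S.natDegree) ∧
      Polynomial.expand F[X] p S =
        ∑ j ∈ Finset.range p, Polynomial.C (Polynomial.X ^ j) * g j ^ p := by
  choose c hc using fun i => exists_eq_sum_X_pow_mul_pow p (S.coeff i)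
  refine ⟨fun j => ∑ i ∈ Finset.range (S.natDegree + 1), Polynomial.monomial i (c i j),
    fun j => Polynomial.natDegree_sum_le_of_forall_le _ _ fun i hi =>
      (Polynomial.natDegree_monomial_le _).trans (by have := Finset.mem_range.mp hi; omega), ?_⟩
  conv_lhs => rw [S.as_sum_range, map_sum]
  simp only [sum_pow_char, Finset.mul_sum]
  rw [Finset.sum_comm]
  refine Finset.sum_congr rfl fun i _ => ?_
  rw [Polynomial.expand_monomial]
  conv_lhs => rw [hc i, map_sum]
  refine Finset.sum_congr rfl fun j _ => ?_
  rw [Polynomial.monomial_pow, Polynomial.C_mul_monomial]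

/-- The orders of the nonzero terms are distinct modulo `p`, so their absolute values are distinct
and they cannot cancel. -/
theorem eq_zero_of_sum_X_pow_mul_pow_eq_zero {p : ℕ} (y : ℕ → F⸨X⸩)
    (h : ∑ j ∈ Finset.range p, polyEmb F (Polynomial.X ^ j) * y j ^ p = 0) :
    ∀ j < p, y j = 0 := by
  by_contra! hne
  obtain ⟨j₀, hj₀, hy₀⟩ := hne
  have hq := one_lt_natCard_real (F := F)
  have hq0 : (0 : ℝ) < Nat.card F := by linarith
  have hnorm : ∀ j, y j ≠ 0 → ‖polyEmb F (Polynomial.X ^ j) * y j ^ p‖ =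
      (Nat.card F : ℝ) ^ ((j : ℤ) + p * -(y j).order) := fun j hj => by
    rw [norm_mul, norm_pow, norm_polyEmb (pow_ne_zero _ Polynomial.X_ne_zero),
      Polynomial.natDegree_X_pow, norm_eq F hj, zpow_add₀ hq0.ne', zpow_natCast, mul_comm (p : ℤ),
      zpow_mul, zpow_natCast]
  classical
  set s := (Finset.range p).filter fun j => y j ≠ 0 with hs
  have hsum : ∑ j ∈ s, polyEmb F (Polynomial.X ^ j) * y j ^ p = 0 := by
    rw [← h, hs]
    refine Finset.sum_filter_of_ne fun j hj hj' hy => hj' ?_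
    rw [hy, zero_pow (by omega), mul_zero]
  have hsne : s.Nonempty := ⟨j₀, by simp [hs, hj₀, hy₀]⟩
  have hsup := IsUltrametricDist.norm_sum_eq_sup'_of_pairwise_ne
    (f := fun j => polyEmb F (Polynomial.X ^ j) * y j ^ p) hsne (by
      intro i hi j hj hij heq
      simp only [hs, Finset.coe_filter, Finset.mem_range, Set.mem_ofPred_eq] at hi hj
      simp only [hnorm i hi.2, hnorm j hj.2] at heq
      have h1 := zpow_right_injective₀ hq0 hq.ne' heq
      have h2 := congrArg (· % (p : ℤ)) h1
      simp only [Int.add_mul_emod_self_left] at h2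
      rw [Int.emod_eq_of_lt (by omega) (by omega), Int.emod_eq_of_lt (by omega) (by omega)] at h2
      exact hij (by exact_mod_cast h2))
  rw [hsum, norm_zero] at hsup
  have hle := Finset.le_sup' (fun j => ‖polyEmb F (Polynomial.X ^ j) * y j ^ p‖)
    (show j₀ ∈ s by simp [hs, hj₀, hy₀])
  rw [← hsup] at hle
  simp only [hnorm j₀ hy₀] at hle
  exact absurd hle (not_le.mpr (by positivity))

/-- Algebraic elements of `F((T⁻¹))` are simple roots of their minimal defining polynomials. -/
theorem IsMinDefPoly.eval₂_derivative_ne_zero {ξ : F⸨X⸩} {P : F[X][X]}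
    (hP : IsMinDefPoly (polyEmb F) ξ P) :
    P.derivative.eval₂ (polyEmb F) ξ ≠ 0 := by
  intro h
  have hdeg := hP.natDegree_ne_zero (polyEmb_injective F)
  have small : ∀ Q : F[X][X], Q.natDegree < P.natDegree → Q.eval₂ (polyEmb F) ξ = 0 → Q = 0 := by
    intro Q hQ h0
    by_contra hne
    exact absurd (Polynomial.natDegree_le_of_dvd (hP.dvd (polyEmb_injective F) h0) hne)
      (not_le.mpr hQ)
  have hder : P.derivative = 0 := small _ (Polynomial.natDegree_derivative_lt hdeg) h
  obtain ⟨p, hchar⟩ := CharP.exists F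
  have hp : Fact p.Prime := ⟨CharP.char_is_prime F p⟩
  -- Now `P = S(X ^ p) = ∑ T ^ j * g j ^ p`. Evaluation at `ξ` forces every `g j` to vanish there,
  -- and their degrees are less than that of `P`, so all of them are zero.
  have hexp := Polynomial.expand_contract p hder hp.out.ne_zero
  set S := Polynomial.contract p P
  obtain ⟨g, hg, hsum⟩ := exists_expand_eq_sum p S
  rw [hexp] at hsum
  have hdegP : P.natDegree = S.natDegree * p := by
    rw [← hexp, Polynomial.natDegree_expand]
  have hS : S.natDegree < P.natDegree := by
    rw [hdegP]
    exact lt_mul_of_one_lt_right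
      (Nat.pos_of_ne_zero fun h0 => hdeg (by rw [hdegP, h0, zero_mul])) hp.out.one_lt
  have hval := hP.2
  rw [hsum, Polynomial.eval₂_finsetSum] at hval
  simp only [Polynomial.eval₂_mul, Polynomial.eval₂_C, Polynomial.eval₂_pow] at hval
  have hy := eq_zero_of_sum_X_pow_mul_pow_eq_zero (fun j => (g j).eval₂ (polyEmb F) ξ) hval
  apply hP.1.ne_zero
  rw [hsum]
  refine Finset.sum_eq_zero fun j hj => ?_
  rw [small (g j) ((hg j).trans_lt hS) (hy j (Finset.mem_range.mp hj)), zero_pow hp.out.ne_zero,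
    mul_zero]

end Separable

section Closer

variable {F : Type*} [Field F] [Finite F]

/-! ### Approximants outside `F((T⁻¹))` are not the best ones -/

theorem one_le_mul_height_pow {P Q : F[X][X]} (hP : Irreducible P) (hPQ : ¬ P ∣ Q) {m : ℕ}
    (hm : Q.natDegree ≤ m) {α : AlgCl F} (hα : α ∉ Set.range (algebraMap F⸨X⸩ (AlgCl F)))
    (h : P.eval₂ (polyEmbCl F) α = 0) (ξ : F⸨X⸩) {δ : ℝ} (hδ : 0 ≤ δ)
    (hQ : ∀ z, ‖algebraMap F⸨X⸩ (AlgCl F) ξ - z‖ = ‖algebraMap F⸨X⸩ (AlgCl F) ξ - α‖ →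
      ‖(Q.map (polyEmbCl F)).eval z‖ ≤ δ * max 1 ‖z‖ ^ m) :
    2 ≤ P.natDegree ∧
      1 ≤ δ ^ 2 * (height P : ℝ) ^ m * (height Q : ℝ) ^ (P.natDegree - 2) := by
  obtain ⟨b, s, hs, hb⟩ := exists_roots_eq_cons_cons hP.ne_zero hα h ξ
  have hdeg := Polynomial.natDegree_map_eq_of_injective (polyEmbCl_injective (F := F)) P
  constructor
  · rw [← hdeg, (IsAlgClosed.splits _).natDegree_eq_card_roots, hs]
    simp
  · have h1 := one_le_norm_resultant hP hPQ hm
    have h2 := norm_resultant_le (IsAlgClosed.splits _)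
      (Polynomial.natDegree_map_le (f := polyEmbCl F).trans hm) hs hδ (hQ α rfl) (hQ b hb)
    rw [supNorm_map_polyEmbCl, supNorm_map_polyEmbCl, hdeg] at h2
    rw [hdeg] at h1
    exact h1.trans h2

theorem exists_isMinDefPoly_of_mem_roots {Q : F[X][X]} (hQ : Q ≠ 0) {β : AlgCl F}
    (hβ : β ∈ (Q.map (polyEmbCl F)).roots) :
    ∃ P, IsMinDefPoly (polyEmbCl F) β P ∧ P.natDegree ≤ Q.natDegree ∧
      (height P : ℝ) ≤ height Q := by
  have h := Polynomial.isRoot_of_mem_roots hβ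
  rw [Polynomial.IsRoot, Polynomial.eval_map] at h
  obtain ⟨P, hd, hP⟩ := exists_isMinDefPoly_dvd hQ h
  exact ⟨P, hP, Polynomial.natDegree_le_of_dvd hd hQ, height_le_of_dvd hd hQ⟩

theorem norm_sub_pos_of_mem_roots {Q : F[X][X]} {ξ : F⸨X⸩} (hξ : Q.eval₂ (polyEmb F) ξ ≠ 0)
    {β : AlgCl F} (hβ : β ∈ (Q.map (polyEmbCl F)).roots) :
    0 < ‖algebraMap F⸨X⸩ (AlgCl F) ξ - β‖ := by
  rw [norm_pos_iff, sub_ne_zero]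
  rintro rfl
  have h := Polynomial.isRoot_of_mem_roots hβ
  rw [Polynomial.IsRoot, eval_map_polyEmbCl_algebraMap, map_eq_zero] at h
  exact hξ h

/-- The set of algebraic elements of degree at most `n` and height at most `B`, different from
`ξ`. -/
def boundedAlgebraic {E : Type*} [Field E] (φ : F[X] →+* E) (n : ℕ) (B : ℝ) (ξ : E) : Set E :=
  {β | β ≠ ξ ∧ ∃ P, IsMinDefPoly φ β P ∧ P.natDegree ≤ n ∧ (height P : ℝ) ≤ B}

theorem finite_boundedAlgebraic {E : Type*} [Field E] {φ : F[X] →+* E}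
    (hφ : Function.Injective φ) (n : ℕ) (B : ℝ) (ξ : E) : (boundedAlgebraic φ n B ξ).Finite :=
  (finite_setOf_isMinDefPoly_height_le hφ n B).subset fun _ h => h.2

theorem exists_closer_of_forall_eval_ne_zero {ξ : F⸨X⸩} {n : ℕ}
    (hξ : ∀ Q : F[X][X], Q ≠ 0 → Q.natDegree ≤ n → Q.eval₂ (polyEmb F) ξ ≠ 0) :
    ∃ B : ℝ, ∀ (α : AlgCl F) (P : F[X][X]), α ∉ Set.range (algebraMap F⸨X⸩ (AlgCl F)) →
      IsMinDefPoly (polyEmbCl F) α P → P.natDegree ≤ n → B < height P →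
      ∃ β ∈ boundedAlgebraic (polyEmbCl F) n (height P) (algebraMap F⸨X⸩ (AlgCl F) ξ),
        ‖algebraMap F⸨X⸩ (AlgCl F) ξ - β‖ < ‖algebraMap F⸨X⸩ (AlgCl F) ξ - α‖ := by
  obtain ⟨C, hC, hDir⟩ := exists_height_le_norm_eval_le ξ n
  refine ⟨max C 1, fun α P hα hP hn hB => ?_⟩
  have hq := one_lt_natCard_real (F := F)
  obtain ⟨hBC, hB1⟩ := max_lt_iff.mp hB
  obtain ⟨M, hM⟩ := exists_height_eq hP.1.ne_zero
  -- With `H = q ^ (N + 1)`, a `Q` of height at most `q ^ N` cannot be divisible by `P`, and the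
  -- factor `q ^ ((N + 1) * n)` in its bound is `H ^ n`.
  obtain ⟨N, rfl⟩ : ∃ N, M = N + 1 := Nat.exists_eq_succ_of_ne_zero fun h0 => by
    rw [hM, h0, pow_zero] at hB1
    exact lt_irrefl _ hB1
  obtain ⟨Q, hQ0, hQn, hQh, hQv⟩ := hDir N
  have hlt : (height Q : ℝ) < height P :=
    hQh.trans_lt (hM ▸ pow_lt_pow_right₀ hq N.lt_succ_self)
  by_contra! hno
  have hroots : ∀ r ∈ (Q.map (polyEmbCl F)).roots,
      ‖algebraMap F⸨X⸩ (AlgCl F) ξ - α‖ ≤ ‖algebraMap F⸨X⸩ (AlgCl F) ξ - r‖ := fun r hr => by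
    obtain ⟨P', hP', hd, hh⟩ := exists_isMinDefPoly_of_mem_roots hQ0 hr
    refine hno r ⟨fun h => ?_, P', hP', hd.trans hQn, hh.trans hlt.le⟩
    have := norm_sub_pos_of_mem_roots (hξ Q hQ0 hQn) hr
    rw [h, sub_self, norm_zero] at this
    exact lt_irrefl _ this
  set δ := ‖Q.eval₂ (polyEmb F) ξ‖ with hδ
  obtain ⟨h2, h1⟩ := one_le_mul_height_pow hP.1 (fun hd => hlt.not_ge (height_le_of_dvd hd hQ0))
    hQn hα hP.2 ξ (norm_nonneg (Q.eval₂ (polyEmb F) ξ)) fun z hz => by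
      have := norm_eval_le_norm_eval (IsAlgClosed.splits _) (fun a ha => hz.le.trans (hroots a ha))
      rw [eval_map_polyEmbCl_algebraMap, norm_algebraMap_algCl] at this
      exact this.trans (le_mul_of_one_le_right (norm_nonneg _)
        (one_le_pow₀ (le_max_left _ _)))
  rw [pow_mul, ← hM] at hQv
  rw [← hδ] at h1
  set H : ℝ := (height P : ℝ) with hH
  have hH0 : 0 < H := by linarith
  have h3 : δ ^ 2 * H ^ n * (height Q : ℝ) ^ (P.natDegree - 2) ≤ δ ^ 2 * H ^ n * H ^ (n - 2) := by
    gcongr ?_ * ?_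
    calc (height Q : ℝ) ^ (P.natDegree - 2) ≤ H ^ (P.natDegree - 2) := by gcongr
      _ ≤ H ^ (n - 2) := pow_le_pow_right₀ hB1.le (by omega)
  have h4 : H ^ 2 ≤ C ^ 2 := by
    calc H ^ 2 ≤ (δ ^ 2 * H ^ n * H ^ (n - 2)) * H ^ 2 :=
          le_mul_of_one_le_left (by positivity) (h1.trans h3)
      _ = (δ * H ^ n) ^ 2 := by
          obtain ⟨k, rfl⟩ : ∃ k, n = k + 2 := ⟨n - 2, by omega⟩
          rw [Nat.add_sub_cancel]
          ring
      _ ≤ C ^ 2 := by gcongr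
  exact absurd h4 (not_le.mpr (by gcongr))

theorem exists_closer_of_isMinDefPoly {ξ : F⸨X⸩} {n : ℕ} {P₀ : F[X][X]}
    (hP₀ : IsMinDefPoly (polyEmb F) ξ P₀) (hn₀ : P₀.natDegree ≤ n) :
    ∃ B : ℝ, ∀ (α : AlgCl F) (P : F[X][X]), α ∉ Set.range (algebraMap F⸨X⸩ (AlgCl F)) →
      IsMinDefPoly (polyEmbCl F) α P → P.natDegree ≤ n → B < height P →
      ∃ β ∈ boundedAlgebraic (polyEmbCl F) n (height P) (algebraMap F⸨X⸩ (AlgCl F) ξ),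
        ‖algebraMap F⸨X⸩ (AlgCl F) ξ - β‖ < ‖algebraMap F⸨X⸩ (AlgCl F) ξ - α‖ := by
  have hq := one_lt_natCard_real (F := F)
  set q : ℝ := (Nat.card F : ℝ) with hqdef
  have hq0 : 0 < q := by linarith
  obtain ⟨e, he⟩ : ∃ e, P₀.natDegree = e + 1 :=
    Nat.exists_eq_succ_of_ne_zero (hP₀.natDegree_ne_zero (polyEmb_injective F))
  -- Degree `e`, one less than that of `ξ`, ensures that the small polynomials do not vanish at `ξ`.
  obtain ⟨C, hC, hDir⟩ := exists_height_le_norm_eval_le ξ e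
  obtain ⟨h, hh⟩ := exists_height_eq hP₀.1.ne_zero
  set D := ‖P₀.derivative.eval₂ (polyEmb F) ξ‖ with hD
  have hD0 : 0 < D := norm_pos_iff.mpr hP₀.eval₂_derivative_ne_zero
  -- `c` is chosen so that `T ^ (N + c + 1) * P₀'(ξ)` dominates `R'(ξ)` for `R` of height at most `q
  -- ^ N`.
  obtain ⟨c, hc⟩ := pow_unbounded_of_one_lt (max 1 ‖ξ‖ ^ n / D) hq
  have hc' : max 1 ‖ξ‖ ^ n < q ^ (c + 1) * D := by
    rw [div_lt_iff₀ hD0] at hc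
    refine hc.trans_le ?_
    gcongr
    · exact hq.le
    · omega
  set C₁ := C * q ^ ((h + c + 1) * (e + 1)) with hC₁
  have hC₁0 : 0 < C₁ := by positivity
  -- The first bound leaves room for `T ^ (N + c + 1) * P₀` within height `H` and prevents `P ∣ P₀`;
  -- the second contradicts the final estimate.
  refine ⟨max (q ^ (h + c + 1)) (C₁ ^ 2 * (q ^ h) ^ n / D ^ 2), fun α P hα hP hn hB => ?_⟩
  obtain ⟨hB1, hB2⟩ := max_lt_iff.mp hB
  obtain ⟨M, hM⟩ := exists_height_eq hP.1.ne_zero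
  rw [← hqdef] at hM hh
  rw [hM] at hB1
  have hMlt := (pow_lt_pow_iff_right₀ hq).mp hB1
  obtain ⟨N, rfl⟩ : ∃ N, M = N + (h + c + 1) := ⟨M - (h + c + 1), by omega⟩
  set H : ℝ := (height P : ℝ) with hH
  have hH1 : 1 ≤ H := hM ▸ one_le_pow₀ hq.le
  -- the distance from `ξ` to `α` is bounded below
  set ρ := ‖algebraMap F⸨X⸩ (AlgCl F) ξ - α‖ with hρ
  have hlow : 1 ≤ ρ ^ 2 * H ^ (e + 1) * (q ^ h) ^ n := by
    obtain ⟨h2, h1⟩ := one_le_mul_height_pow hP.1 (Q := P₀) (m := e + 1) (fun hd => by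
        have := height_le_of_dvd hd hP₀.1.ne_zero
        rw [← hH, hM, hh, pow_le_pow_iff_right₀ hq] at this
        omega) he.le hα hP.2 ξ (δ := ρ * height P₀) (by positivity) fun z hz => by
      have h0 : (P₀.map (polyEmbCl F)).eval (algebraMap F⸨X⸩ (AlgCl F) ξ) = 0 := by
        rw [eval_map_polyEmbCl_algebraMap, hP₀.2, map_zero]
      have := norm_eval_le_of_eval_eq_zero (Polynomial.natDegree_map_le.trans he.le) h0 z
      rwa [supNorm_map_polyEmbCl, hz] at this
    rw [hh, ← hH] at h1
    refine h1.trans (le_of_eq_of_le (b := ρ ^ 2 * H ^ (e + 1) * (q ^ h) ^ P.natDegree) ?_ ?_)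
    · obtain ⟨k, hk⟩ : ∃ k, P.natDegree = k + 2 := ⟨P.natDegree - 2, by omega⟩
      rw [hk, Nat.add_sub_cancel]
      ring
    · gcongr
      exact one_le_pow₀ hq.le
  -- a polynomial with a root closer to `ξ`
  obtain ⟨R, hR0, hRe, hRh, hRv⟩ := hDir N
  rw [← hqdef] at hRh hRv
  have hRξ : R.eval₂ (polyEmb F) ξ ≠ 0 := fun h0 => by
    have := Polynomial.natDegree_le_of_dvd (hP₀.dvd (polyEmb_injective F) h0) hR0
    omega
  -- `Q` has the tiny value `R(ξ)` at `ξ` but a large derivative there, hence a root very close to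
  -- `ξ`, which is not `ξ` itself.
  set Q : F[X][X] := Polynomial.C (Polynomial.X ^ (N + c + 1)) * P₀ + R with hQ
  have hT : ‖polyEmb F (Polynomial.X ^ (N + c + 1))‖ = q ^ (N + c + 1) := by
    rw [norm_polyEmb (pow_ne_zero _ Polynomial.X_ne_zero), Polynomial.natDegree_X_pow]
  have hQξ : Q.eval₂ (polyEmb F) ξ = R.eval₂ (polyEmb F) ξ := by
    rw [hQ, Polynomial.eval₂_add, Polynomial.eval₂_mul, hP₀.2, mul_zero, zero_add]
  have hQ0 : Q ≠ 0 := fun h0 => hRξ (by rw [← hQξ, h0, Polynomial.eval₂_zero])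
  have hQn : Q.natDegree ≤ n := by
    refine (Polynomial.natDegree_add_le _ _).trans (max_le ?_ (by omega))
    exact (Polynomial.natDegree_C_mul_le _ _).trans hn₀
  have hQh : (height Q : ℝ) ≤ H := by
    rw [height_le_iff (by positivity)]
    intro i
    rw [hQ, Polynomial.coeff_add, Polynomial.coeff_C_mul, map_add, map_mul]
    refine (IsUltrametricDist.norm_add_le_max _ _).trans (max_le ?_ ?_)
    · rw [norm_mul, hT]
      calc _ ≤ q ^ (N + c + 1) * q ^ h := by
            gcongr
            exact (norm_coeff_le_height P₀ i).trans hh.le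
        _ = H := by rw [hM]; ring
    · refine (norm_coeff_le_height R i).trans (hRh.trans ?_)
      rw [hM]
      exact pow_le_pow_right₀ hq.le (by omega)
  have hder : ‖(Q.map (polyEmbCl F)).derivative.eval (algebraMap F⸨X⸩ (AlgCl F) ξ)‖ =
      q ^ (N + c + 1) * D := by
    rw [Polynomial.derivative_map, eval_map_polyEmbCl_algebraMap, norm_algebraMap_algCl, hQ,
      Polynomial.derivative_add, Polynomial.derivative_C_mul, Polynomial.eval₂_add,
      Polynomial.eval₂_mul, Polynomial.eval₂_C]
    have hbig : ‖polyEmb F (Polynomial.X ^ (N + c + 1)) * P₀.derivative.eval₂ (polyEmb F) ξ‖ =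
        q ^ (N + c + 1) * D := by rw [norm_mul, hT]
    have hsmall : ‖R.derivative.eval₂ (polyEmb F) ξ‖ < q ^ (N + c + 1) * D := by
      have h1 : ‖R.derivative.eval₂ (polyEmb F) ξ‖ ≤ q ^ N * max 1 ‖ξ‖ ^ n := by
        refine (norm_eval₂_le (n := n) ?_ ξ).trans ?_
        · exact (Polynomial.natDegree_derivative_le R).trans (by omega)
        · gcongr
          refine le_trans ?_ hRh
          simp only [← supNorm_map_eq_height (φ := polyEmb F) (fun _ => rfl),
            ← Polynomial.derivative_map]
          exact supNorm_derivative_le _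
      calc _ ≤ _ := h1
        _ < q ^ N * (q ^ (c + 1) * D) := by gcongr
        _ = _ := by ring
    rw [← hbig] at hsmall ⊢
    rw [IsUltrametricDist.norm_add_eq_max_of_norm_ne_norm hsmall.ne', max_eq_left hsmall.le]
  obtain ⟨β, hβ, hβle⟩ := exists_root_norm_sub_mul_le (IsAlgClosed.splits (Q.map (polyEmbCl F)))
    (x := algebraMap F⸨X⸩ (AlgCl F) ξ) (norm_pos_iff.mp (by rw [hder]; positivity))
  rw [hder, eval_map_polyEmbCl_algebraMap, norm_algebraMap_algCl, hQξ] at hβle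
  have hβpos := norm_sub_pos_of_mem_roots (hQξ ▸ hRξ) hβ
  obtain ⟨P', hP', hd', hh'⟩ := exists_isMinDefPoly_of_mem_roots hQ0 hβ
  refine ⟨β, ⟨fun h0 => ?_, P', hP', hd'.trans hQn, hh'.trans hQh⟩, ?_⟩
  · rw [h0, sub_self, norm_zero] at hβpos
    exact lt_irrefl _ hβpos
  set σ := ‖algebraMap F⸨X⸩ (AlgCl F) ξ - β‖ with hσ
  by_contra! hle
  have hup : σ * H ^ (e + 1) * D ≤ C₁ := by
    calc σ * H ^ (e + 1) * D
        = σ * (q ^ N * D) * q ^ (N * e) * q ^ ((h + c + 1) * (e + 1)) := by rw [hM]; ring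
      _ ≤ σ * (q ^ (N + c + 1) * D) * q ^ ((N + 1) * e) * q ^ ((h + c + 1) * (e + 1)) := by
          gcongr <;> first | exact hq.le | omega
      _ ≤ ‖R.eval₂ (polyEmb F) ξ‖ * q ^ ((N + 1) * e) * q ^ ((h + c + 1) * (e + 1)) := by
          gcongr
      _ ≤ C₁ := by rw [hC₁]; gcongr
  have hfin : H * D ^ 2 ≤ C₁ ^ 2 * (q ^ h) ^ n := by
    calc H * D ^ 2 ≤ H ^ (e + 1) * D ^ 2 := by
          gcongr
          exact le_self_pow₀ hH1 (by omega)
      _ ≤ (σ ^ 2 * H ^ (e + 1) * (q ^ h) ^ n) * (H ^ (e + 1) * D ^ 2) := by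
          refine le_mul_of_one_le_left (by positivity) (hlow.trans ?_)
          gcongr
      _ = (σ * H ^ (e + 1) * D) ^ 2 * (q ^ h) ^ n := by ring
      _ ≤ C₁ ^ 2 * (q ^ h) ^ n := by gcongr
  rw [div_lt_iff₀ (by positivity)] at hB2
  exact absurd hfin (not_le.mpr hB2)

theorem exists_closer (ξ : F⸨X⸩) (n : ℕ) :
    ∃ B : ℝ, ∀ (α : AlgCl F) (P : F[X][X]), α ∉ Set.range (algebraMap F⸨X⸩ (AlgCl F)) →
      IsMinDefPoly (polyEmbCl F) α P → P.natDegree ≤ n → B < height P →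
      ∃ β ∈ boundedAlgebraic (polyEmbCl F) n (height P) (algebraMap F⸨X⸩ (AlgCl F) ξ),
        ‖algebraMap F⸨X⸩ (AlgCl F) ξ - β‖ < ‖algebraMap F⸨X⸩ (AlgCl F) ξ - α‖ := by
  by_cases hξ : ∀ Q : F[X][X], Q ≠ 0 → Q.natDegree ≤ n → Q.eval₂ (polyEmb F) ξ ≠ 0
  · exact exists_closer_of_forall_eval_ne_zero hξ
  · push Not at hξ
    obtain ⟨Q, hQ0, hQn, hQ⟩ := hξ
    obtain ⟨P₀, hd, hP₀⟩ := exists_isMinDefPoly_dvd hQ0 hQ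
    exact exists_closer_of_isMinDefPoly hP₀ ((Polynomial.natDegree_le_of_dvd hd hQ0).trans hQn)

theorem exists_pos_le_norm_sub {E : Type*} [NormedField E] {S : Set E} (hS : S.Finite) {x : E}
    (hx : x ∉ S) : ∃ δ > 0, ∀ y ∈ S, δ ≤ ‖x - y‖ := by
  rcases S.eq_empty_or_nonempty with rfl | hne
  · exact ⟨1, one_pos, by simp⟩
  obtain ⟨a, ha, hmin⟩ := S.exists_min_image (fun y => ‖x - y‖) hS hne
  refine ⟨‖x - a‖, norm_pos_iff.mpr (sub_ne_zero.mpr fun h => hx (h ▸ ha)), hmin⟩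

/-- Close approximants in the algebraic closure can be replaced with approximants in `F((T⁻¹))`
that are no worse. -/
theorem exists_approximant_mem (ξ : F⸨X⸩) (n : ℕ) :
    ∃ δ > 0, ∀ (α : AlgCl F) (P : F[X][X]), IsMinDefPoly (polyEmbCl F) α P → P.natDegree ≤ n →
      0 < ‖algebraMap F⸨X⸩ (AlgCl F) ξ - α‖ → ‖algebraMap F⸨X⸩ (AlgCl F) ξ - α‖ < δ →
      ∃ β ∈ boundedAlgebraic (polyEmb F) n (height P) ξ,
        ‖ξ - β‖ ≤ ‖algebraMap F⸨X⸩ (AlgCl F) ξ - α‖ := by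
  obtain ⟨B, hB⟩ := exists_closer ξ n
  obtain ⟨δ, hδ, hδB⟩ := exists_pos_le_norm_sub
    (finite_boundedAlgebraic polyEmbCl_injective n B (algebraMap F⸨X⸩ (AlgCl F) ξ))
    (fun h => h.1 rfl)
  refine ⟨δ, hδ, fun α P hP hn hpos hlt => ?_⟩
  obtain ⟨β, ⟨hβξ, P', hP', hd', hh'⟩, hmin⟩ := Set.exists_min_image _
    (fun y => ‖algebraMap F⸨X⸩ (AlgCl F) ξ - y‖)
    (finite_boundedAlgebraic polyEmbCl_injective n (height P) (algebraMap F⸨X⸩ (AlgCl F) ξ))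
    ⟨α, fun h => by simp [h] at hpos, P, hP, hn, le_rfl⟩
  have hβα := hmin α ⟨fun h => by simp [h] at hpos, P, hP, hn, le_rfl⟩
  -- `δ` is below the distance from `ξ` to every candidate of height at most `B`.
  have hBP : B < height P' := by
    by_contra! h
    exact absurd (hδB β ⟨hβξ, P', hP', hd', h⟩) (not_le.mpr (hβα.trans_lt hlt))
  by_cases hβ : β ∈ Set.range (algebraMap F⸨X⸩ (AlgCl F))
  · obtain ⟨β, rfl⟩ := hβ
    refine ⟨β, ⟨fun h => hβξ (h ▸ rfl), P', (isMinDefPoly_comp_iff _ _ _ _).mp hP', hd', hh'⟩, ?_⟩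
    rwa [← map_sub, norm_algebraMap_algCl] at hβα
  · obtain ⟨γ, ⟨hγξ, P'', hP'', hd'', hh''⟩, hγ⟩ := hB β P' hβ hP' hd' hBP
    exact absurd (hmin γ ⟨hγξ, P'', hP'', hd'', hh''.trans hh'⟩) (not_le.mpr hγ)

end Closer

section Exponents

variable {F : Type*} [Field F] [Finite F]

/-! ### Comparison of the exponents -/

theorem image_approximants_subset {E E' : Type*} [NormedField E] [NormedField E']
    (φ : F[X] →+* E) (ψ : E →+* E') (hψ : ∀ x, ‖ψ x‖ = ‖x‖) (n : ℕ) (ξ : E) (w : ℝ) :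
    ψ '' approximants φ n ξ w ⊆ approximants (ψ.comp φ) n (ψ ξ) w := by
  rintro _ ⟨α, ⟨P, hP, hn, h0, h1⟩, rfl⟩
  refine ⟨P, (isMinDefPoly_comp_iff φ ψ α P).mpr hP, hn, ?_⟩
  rw [← map_sub, hψ]
  exact ⟨h0, h1⟩

theorem exponent_le_exponent_comp {E E' : Type*} [NormedField E] [NormedField E']
    (φ : F[X] →+* E) (ψ : E →+* E') (hψ : ∀ x, ‖ψ x‖ = ‖x‖) (n : ℕ) (ξ : E) :
    exponent φ n ξ ≤ exponent (ψ.comp φ) n (ψ ξ) :=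
  sSup_le_sSup (Set.image_mono fun w hw =>
    (Set.Infinite.image ψ.injective.injOn hw).mono (image_approximants_subset φ ψ hψ n ξ w))

/-- The minimal defining polynomial splits over the algebraic closure, so completion adds no roots.
-/
theorem exists_coe_eq_of_isMinDefPoly {α : CInfty F} {P : F[X][X]}
    (hP : IsMinDefPoly ((toCInfty F).comp (polyEmb F)) α P) :
    ∃ a : AlgCl F, (a : CInfty F) = α := by
  have h0 : P.map (polyEmbCl F) ≠ 0 :=
    (Polynomial.map_ne_zero_iff polyEmbCl_injective).mpr hP.1.ne_zero
  have h := hP.2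
  rw [show (toCInfty F).comp (polyEmb F) =
    (UniformSpace.Completion.coeRingHom : AlgCl F →+* CInfty F).comp (polyEmbCl F) from rfl,
    ← Polynomial.eval₂_map] at h
  obtain ⟨a, ha⟩ := (IsAlgClosed.splits (P.map (polyEmbCl F))).mem_range_of_isRoot h0
    (i := (UniformSpace.Completion.coeRingHom : AlgCl F →+* CInfty F)) (x := α)
    (by rwa [Polynomial.IsRoot, Polynomial.eval_map])
  exact ⟨a, ha⟩

theorem wAt_le_exponent_polyEmbCl (n : ℕ) (ξ : F⸨X⸩) :
    wAt n ξ ≤ exponent (polyEmbCl F) n (algebraMap F⸨X⸩ (AlgCl F) ξ) := by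
  refine sSup_le_sSup (Set.image_mono fun w hw => ?_)
  refine Set.Infinite.of_image (UniformSpace.Completion.coeRingHom : AlgCl F →+* CInfty F)
    (Set.Infinite.mono ?_ hw)
  rintro α ⟨P, hP, hn, h⟩
  obtain ⟨a, rfl⟩ := exists_coe_eq_of_isMinDefPoly hP
  refine ⟨a, ⟨P, (isMinDefPoly_comp_iff (polyEmbCl F)
    (UniformSpace.Completion.coeRingHom : AlgCl F →+* CInfty F) a P).mp hP, hn, ?_⟩, rfl⟩
  rwa [← UniformSpace.Completion.norm_coe (E := AlgCl F), UniformSpace.Completion.coe_sub]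

theorem wStar_le_wAt (n : ℕ) (ξ : F⸨X⸩) : wStar n ξ ≤ wAt n ξ :=
  exponent_le_exponent_comp (polyEmb F) (toCInfty F) (norm_toCInfty F) n ξ

/-- The elements `T ^ (-m)` show that `w_n^*(ξ) ≥ -1`. -/
theorem infinite_approximants_of_lt_neg_one {n : ℕ} (hn : 1 ≤ n) (ξ : F⸨X⸩) {w : ℝ}
    (hw : w < -1) : (approximants (polyEmb F) n ξ w).Infinite := by
  obtain ⟨B, hB⟩ := Filter.eventually_atTop.mp
    ((tendsto_rpow_atTop (show 0 < -w - 1 by linarith)).eventually_gt_atTop (max ‖ξ‖ 1))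
  let a : ℕ → F⸨X⸩ := fun m => (polyEmb F (Polynomial.X ^ m))⁻¹
  have hX : ∀ m, polyEmb F (Polynomial.X ^ m) ≠ 0 := fun m =>
    (map_ne_zero_iff _ (polyEmb_injective F)).mpr (pow_ne_zero _ Polynomial.X_ne_zero)
  have ha : Function.Injective a := fun i j hij => by
    have := polyEmb_injective F (inv_injective hij)
    simpa using congrArg Polynomial.natDegree this
  -- Only finitely many `T ^ (-m)` have height at most `B`; for the others `H ^ (-w - 1)` exceeds
  -- `max ‖ξ‖ 1`.
  refine (((Set.infinite_range_of_injective ha).sdiff (finite_setOf_isMinDefPoly_height_le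
    (polyEmb_injective F) n B)).sdiff (Set.finite_singleton ξ)).mono ?_
  rintro _ ⟨⟨⟨m, rfl⟩, hm⟩, hmξ⟩
  set Q : F[X][X] := Polynomial.C (Polynomial.X ^ m) * Polynomial.X + Polynomial.C (-1) with hQ
  have hQ0 : Q ≠ 0 := fun h => by
    have := congrArg (fun R => Polynomial.coeff R 0) h
    simp [hQ] at this
  have hQa : Q.eval₂ (polyEmb F) (a m) = 0 := by
    simp only [hQ, a, Polynomial.eval₂_add, Polynomial.eval₂_mul, Polynomial.eval₂_C,
      Polynomial.eval₂_X, mul_inv_cancel₀ (hX m)]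
    simp
  obtain ⟨P, hd, hP⟩ := exists_isMinDefPoly_dvd hQ0 hQa
  have hPn : P.natDegree ≤ n :=
    ((Polynomial.natDegree_le_of_dvd hd hQ0).trans Polynomial.natDegree_linear_le).trans hn
  refine ⟨P, hP, hPn, norm_pos_iff.mpr (sub_ne_zero.mpr fun h => hmξ h.symm), ?_⟩
  have hBP : B ≤ height P := by
    by_contra! h
    exact hm ⟨P, hP, hPn, h.le⟩
  refine lt_of_le_of_lt ?_ (hB _ hBP)
  rw [sub_eq_add_neg]
  refine (IsUltrametricDist.norm_add_le_max _ _).trans (max_le_max le_rfl ?_)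
  rw [norm_neg, norm_inv]
  exact inv_le_one_of_one_le₀ (one_le_norm_polyEmb (pow_ne_zero _ Polynomial.X_ne_zero))

/-- For `w > -1`, approximants of large height are arbitrarily close to `ξ`. Their replacements `β`
in `F((T⁻¹))` are as close and of no larger height, so they satisfy the same inequality, and
finitely many such `β` would stay away from `ξ`. -/
theorem infinite_approximants_of_infinite {n : ℕ} {ξ : F⸨X⸩} {w : ℝ} (hw : -1 < w)
    (h : (approximants (polyEmbCl F) n (algebraMap F⸨X⸩ (AlgCl F) ξ) w).Infinite) :
    (approximants (polyEmb F) n ξ w).Infinite := by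
  intro hfin
  obtain ⟨δ, hδ, hmem⟩ := exists_approximant_mem ξ n
  obtain ⟨δ', hδ', hδ'w⟩ := exists_pos_le_norm_sub hfin (x := ξ) (by
    rintro ⟨P, _, _, h0, _⟩
    simp at h0)
  obtain ⟨B, hB⟩ := Filter.eventually_atTop.mp
    ((tendsto_rpow_neg_atTop (show 0 < w + 1 by linarith)).eventually_lt_const
      (lt_min hδ hδ'))
  obtain ⟨α, ⟨P, hP, hn, hpos, hlt⟩, hα⟩ := (h.sdiff (finite_setOf_isMinDefPoly_height_le
    polyEmbCl_injective n B)).nonempty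
  have hBP : B ≤ height P := by
    by_contra! h'
    exact hα ⟨P, hP, hn, h'.le⟩
  have hsmall := hB _ hBP
  rw [neg_add'] at hsmall
  obtain ⟨h1, h2⟩ := lt_min_iff.mp (hlt.trans hsmall)
  obtain ⟨β, ⟨hβξ, P', hP', hn', hh'⟩, hβ⟩ := hmem α P hP hn hpos h1
  refine absurd (hδ'w β ⟨P', hP', hn', norm_pos_iff.mpr (sub_ne_zero.mpr hβξ.symm), ?_⟩)
    (not_le.mpr (hβ.trans_lt h2))
  refine (hβ.trans_lt hlt).trans_le ?_
  exact Real.rpow_le_rpow_of_nonpos (zero_lt_one.trans_le (one_le_height hP'.1.ne_zero)) hh'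
    (by linarith)

theorem neg_one_le_wStar {n : ℕ} (hn : 1 ≤ n) (ξ : F⸨X⸩) : ((-1 : ℝ) : EReal) ≤ wStar n ξ := by
  refine le_of_forall_lt fun c hc => ?_
  obtain ⟨w, hcw, hw⟩ := EReal.lt_iff_exists_real_btwn.mp hc
  exact hcw.trans_le (le_sSup ⟨w, infinite_approximants_of_lt_neg_one hn ξ
    (EReal.coe_lt_coe_iff.mp hw), rfl⟩)

theorem exponent_polyEmbCl_le_wStar {n : ℕ} (hn : 1 ≤ n) (ξ : F⸨X⸩) :
    exponent (polyEmbCl F) n (algebraMap F⸨X⸩ (AlgCl F) ξ) ≤ wStar n ξ := by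
  refine sSup_le ?_
  rintro _ ⟨w, hw, rfl⟩
  rcases le_or_gt w (-1) with h | h
  -- For `w ≤ -1` the inequality does not force `α` to be near `ξ`, so no replacement is available;
  -- the lower bound `-1` suffices.
  · exact (EReal.coe_le_coe_iff.mpr h).trans (neg_one_le_wStar hn ξ)
  · exact le_sSup ⟨w, infinite_approximants_of_infinite h hw, rfl⟩

end Exponents

end KoksmaExponents

end

theorem theorem1p2 {F : Type*} [Field F] [Finite F] (ξ : LaurentSeries F) (n : ℕ) (hn : 1 ≤ n) :
    KoksmaExponents.wStar n ξ = KoksmaExponents.wAt n ξ :=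
  le_antisymm (KoksmaExponents.wStar_le_wAt n ξ)
    ((KoksmaExponents.wAt_le_exponent_polyEmbCl n ξ).trans
      (KoksmaExponents.exponent_polyEmbCl_le_wStar hn ξ))
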